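/- Let \(\mathcal A\) and \(\mathcal B\) be structures in the same relational vocabulary, with domains \(A\) and \(B\), taken to be disjoint. In the Ehrenfeucht–Fraïssé game of length \(\omega_1\) on \(\mathcal A\) and \(\mathcal B\), in each round \(\beta<\omega_1\) player \(\forall\) plays an element \(x_\beta\in A\cup B\), and then player \(\exists\) plays an element \(y_\beta\) of \(B\) if \(x_\beta\in A\), and of \(A\) if \(x_\beta\in B\); both players know all earlier moves. Let \(\pi\subseteq A\times B\) be the set of all pairs \((a,b)\) such that \(\{x_\beta,y_\beta\}=\{a,b\}\) for some \(\beta<\omega_1\). Player \(\exists\) wins the play if \(\pi\) is a partial isomorphism (the graph of an injective partial function from \(A\) to \(B\) that preserves all relations in both directions); otherwise \(\forall\) wins. The game is determined if one of the two players has a winning strategy. **Theorem (ZFC).** For every cardinal \(\kappa\ge\aleph_3\) (in particular for \(\kappa=\aleph_3\)) there are structures \(\mathcal A\) and \(\mathcal B\) of cardinality \(\kappa\), in the vocabulary that consists of one binary predicate, such that the Ehrenfeucht–Fraïssé game of length \(\omega_1\) on \(\mathcal A\) and \(\mathcal B\) is not determined. -/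

import Mathlib

open Cardinal Ordinal
open scoped FirstOrder

universe u v

namespace EFGame

/-- The relation symbols of the vocabulary with exactly one symbol, which is binary. -/
inductive BinaryRel : ℕ → Type
  | rel : BinaryRel 2

/-- The relational vocabulary whose only symbol is one binary predicate. -/
def binaryLanguage : FirstOrder.Language.{0, 0} where
  Functions := fun _ => Empty
  Relations := BinaryRel

instance : binaryLanguage.IsRelational := fun _ => inferInstanceAs (IsEmpty Empty)

section Game

variable (L : FirstOrder.Language.{0, 0}) [L.IsRelational]
variable (A B : Type u) [L.Structure A] [L.Structure B]

/-- A move is an element of the disjoint union of the two domains. -/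
abbrev Move : Type u := A ⊕ B

/-- A run of `α` rounds `⟨(x_β, y_β) : β < α⟩`: in round `β` player `∀` plays `x_β` and
then player `∃` plays `y_β`. -/
abbrev Run (α : Ordinal.{v}) : Type (max u (v + 1)) := Set.Iio α → Move A B × Move A B

variable {A B}

/-- The rounds of a run that precede round `β`. -/
def Run.before {γ : Ordinal.{v}} (p : Run A B γ) (β : Set.Iio γ) : Run A B β.1 :=
  fun δ => p ⟨δ.1, Set.mem_Iio.2 (lt_trans (Set.mem_Iio.1 δ.2) (Set.mem_Iio.1 β.2))⟩

/-- In each round, player `∃` answers in the structure that `∀` did not choose. -/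
def Run.ExistsObeysRules {γ : Ordinal.{v}} (p : Run A B γ) : Prop :=
  ∀ β, ((p β).1.isLeft ∧ (p β).2.isRight) ∨ ((p β).1.isRight ∧ (p β).2.isLeft)

/-- The relation `π ⊆ A × B` determined by a run. -/
def Run.relation {γ : Ordinal.{v}} (p : Run A B γ) : Set (A × B) :=
  {ab | ∃ β, p β = (Sum.inl ab.1, Sum.inr ab.2) ∨ p β = (Sum.inr ab.2, Sum.inl ab.1)}

/-- `π ⊆ A × B` is a partial isomorphism between structures of a relational vocabulary:
it is the graph of an injective partial function that preserves all relations in both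
directions. -/
structure IsPartialIso (π : Set (A × B)) : Prop where
  eq_iff : ∀ p ∈ π, ∀ q ∈ π, p.1 = q.1 ↔ p.2 = q.2
  rel_iff : ∀ (n : ℕ) (R : L.Relations n) (t : Fin n → A × B), (∀ i, t i ∈ π) →
    (FirstOrder.Language.Structure.RelMap R (fun i => (t i).1) ↔
      FirstOrder.Language.Structure.RelMap R (fun i => (t i).2))

/-- Player `∃` wins the given complete run; otherwise player `∀` wins it. -/
def Run.WonByExists {γ : Ordinal.{v}} (p : Run A B γ) : Prop :=
  p.ExistsObeysRules ∧ IsPartialIso L p.relation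

variable (A B)

/-- A strategy of `∀` chooses `x_β` from the preceding rounds. -/
abbrev ForallStrategy (γ : Ordinal.{v}) : Type (max u (v + 1)) :=
  ∀ β : Set.Iio γ, Run A B β.1 → Move A B

/-- A strategy of `∃` chooses `y_β` from the preceding rounds and `x_β`. -/
abbrev ExistsStrategy (γ : Ordinal.{v}) : Type (max u (v + 1)) :=
  ∀ β : Set.Iio γ, Run A B β.1 → Move A B → Move A B

/-- Player `∀` has a winning strategy in the game of length `γ`. -/
def ForallWins (γ : Ordinal.{v}) : Prop :=
  ∃ τ : ForallStrategy A B γ, ∀ p : Run A B γ,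
    (∀ β, (p β).1 = τ β (p.before β)) → ¬ p.WonByExists L

/-- Player `∃` has a winning strategy in the game of length `γ`. -/
def ExistsWins (γ : Ordinal.{v}) : Prop :=
  ∃ τ : ExistsStrategy A B γ, ∀ p : Run A B γ,
    (∀ β, (p β).2 = τ β (p.before β) (p β).1) → p.WonByExists L

/-- The Ehrenfeucht–Fraïssé game of length `γ` on `A` and `B` is determined. -/
def Determined (γ : Ordinal.{v}) : Prop :=
  ForallWins L A B γ ∨ ExistsWins L A B γ

end Game

end EFGame

/-!
The structures code the search for a function `h` on `Λ = ω₃` that jumps over all points of a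
stationary set `E` of limit points of cofinality `ω`: for `γ ∈ E` with a ladder `η γ`, almost all
`n` satisfy `h (η γ n) ≥ γ`. A stationary set has closure points of `h` among its elements, so
there is no such function on all of `Λ`; but `Λ` carries a coherent system of such functions on
initial segments.

*The combinatorics* (`exists_coherent_jumps`). Index the points below each `δ < ω₃` by ordinals below
`ω₂`, and let `D i δ` be the set of points with index below `i`. If `δ` has cofinality `ω₁`, then for
suitable `i` of cofinality `ω₁` the set `D i δ` is unbounded in `δ`, closed under suprema of sequences,
and coherent: `D i β = D i δ ∩ β` for `β ∈ D i δ`. One index `i` serves a stationary set of `δ`, which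
can be thinned out to a stationary set `T` on which the rank of `δ` for the well-founded relation
`β ∈ D i δ` is constant. The limits of cofinality `ω` in these sets form a stationary set,
so that those of some fixed rank `ξ` form a stationary set `E`. If the points of rank at most `ξ`
are removed from `D i δ`, then no limit of the remaining set lies in `E`, and its next-point
function `h δ` has the desired property below `δ`. That `ω₂` lies strictly between `ω₁` and `ω₃`
leaves room for indices of cofinality `ω₁`, so that no assumption beyond ZFC is needed.

*The coding.* A system of conditions, each of which asks that a set of variables contain only
finitely many true ones, with a prescribed parity, is coded by two structures which differ
only in the parities (`Node.Rel`). Exchanging the two values of the variables that are true in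
a partial solution is a partial isomorphism (`isPartialIso_flip`). Conversely, an answer of `∃` to
the empty set at a condition is a finite set of variables of the right parity, and answers at different
conditions agree on common variables (`IsWinningSystem.mem_iff`). The existence of `h` is such a system:
the values `h i` are sets of odd size instead of singletons.

*Neither player wins.* Against a strategy of `∀`, player `∃` answers according to `h δ`, where `δ ∈ T` is
closed under the bounds of all runs in which the answers come from some `h γ` (`not_forallWins`); by
coherence, and as `δ` has uncountable cofinality, such a run stays below `δ` for `ω₁` rounds. Against a
strategy of `∃`, player `∀` asks for the values along the ladder of a point `γ ∈ E` that is closed under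
the answers to all finite sequences of questions, and then has `∃` confirm
that almost all of these values are at least `γ`, which they are not (`not_existsWins_jump`).
-/

namespace EFGame

/-! ### Stationarity over successor cardinals -/

/-- `L` behaves like the successor cardinal `μ⁺`: proper initial segments have cardinality at
most `μ`, and subsets of cardinality at most `μ` are strictly bounded. -/
structure IsSuccLike (L : Type u) [LinearOrder L] (μ : Cardinal.{u}) : Prop where
  mk_Iic_le : ∀ x : L, #(Set.Iic x) ≤ μ
  exists_gt : ∀ s : Set L, #s ≤ μ → ∃ b, ∀ y ∈ s, y < b

theorem isSuccLike_succ_ord {μ : Cardinal.{u}} (hμ : ℵ₀ ≤ μ) :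
    IsSuccLike (Order.succ μ).ord.ToType μ where
  mk_Iic_le x := by
    rw [← Order.lt_succ_iff]
    exact (mk_Iic_lt x (by simp) (by simpa using hμ.trans (Order.le_succ μ))).trans_eq
      (mk_ord_toType _)
  exists_gt s hs := by
    refine not_isCofinal_iff.1 fun h => ?_
    have h1 := Order.cof_le h
    have h2 := (isRegular_succ hμ).cof_ord
    rw [← Ordinal.cof_toType] at h2
    rw [h2] at h1
    exact absurd (h1.trans hs) (not_le.2 (Order.lt_succ μ))

section SuccLike

variable {L : Type u} [LinearOrder L] {μ : Cardinal.{u}}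

theorem IsSuccLike.exists_gt_range (hL : IsSuccLike L μ) {ι : Type u} (hι : #ι ≤ μ) (f : ι → L) :
    ∃ b, ∀ i, f i < b := by
  obtain ⟨b, hb⟩ := hL.exists_gt (Set.range f) (mk_range_le.trans hι)
  exact ⟨b, fun i => hb _ ⟨i, rfl⟩⟩

theorem IsSuccLike.exists_gt_insert (hL : IsSuccLike L μ) (hμ : ℵ₀ ≤ μ) {s : Set L} (hs : #s ≤ μ)
    (a : L) : ∃ b, a < b ∧ ∀ y ∈ s, y < b := by
  obtain ⟨b, hb⟩ := hL.exists_gt (insert a s)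
    (mk_insert_le.trans ((add_le_add_left hs 1).trans (by rw [add_one_eq hμ])))
  exact ⟨b, hb _ (Set.mem_insert _ _), fun y hy => hb _ (Set.mem_insert_of_mem _ hy)⟩

/-- `δ` is a limit point of cofinality `ω₁`: no countable set is cofinal below `δ` (the empty set
included, so that `δ` is not minimal), but some set of cardinality at most `ℵ₁` is. -/
structure HasCofOmegaOne (δ : L) : Prop where
  exists_gt : ∀ s : Set L, s.Countable → (∀ x ∈ s, x < δ) → ∃ b < δ, ∀ x ∈ s, x < b
  exists_cofinal : ∃ Z : Set L, #Z ≤ ℵ₁ ∧ (∀ z ∈ Z, z < δ) ∧ ∀ x < δ, ∃ z ∈ Z, x ≤ z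

/-- `T` contains a closure point of every function. Over a successor cardinal this says that `T`
is stationary, provided that the least element, vacuously a closure point, is not in `T`. -/
def MeetsClosurePoints (T : Set L) : Prop :=
  ∀ g : L → L, ∃ δ ∈ T, ∀ x < δ, g x < δ

/-- A function majorizing `g` on initial segments, whose value at `x` also exceeds `x`. -/
theorem IsSuccLike.exists_majorant (hL : IsSuccLike L μ) (hμ : ℵ₀ ≤ μ) (g : L → L) :
    ∃ G : L → L, ∀ x, x < G x ∧ ∀ y ≤ x, g y < G x := by
  have (x : L) : ∃ b, x < b ∧ ∀ y ≤ x, g y < b := by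
    obtain ⟨b, hb, hb'⟩ := hL.exists_gt_insert hμ (s := g '' Set.Iic x)
      (mk_image_le.trans (hL.mk_Iic_le x)) x
    exact ⟨b, hb, fun y hy => hb' _ ⟨y, hy, rfl⟩⟩
  choose G hG using this
  exact ⟨G, hG⟩

theorem IsSuccLike.exists_closurePoint [WellFoundedLT L] (hL : IsSuccLike L μ) (hμ : ℵ₁ ≤ μ)
    (g : L → L) (a : L) : ∃ δ, a < δ ∧ (∀ x < δ, g x < δ) ∧ HasCofOmegaOne δ := by
  have hμ₀ : ℵ₀ ≤ μ := aleph0_lt_aleph_one.le.trans hμ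
  obtain ⟨G, hG⟩ := hL.exists_majorant hμ₀ g
  let W : Type u := (Order.succ (ℵ₀ : Cardinal.{u})).ord.ToType
  have hW : IsSuccLike W ℵ₀ := isSuccLike_succ_ord le_rfl
  have hWcard : #W = ℵ₁ := by
    rw [mk_ord_toType, succ_aleph0]
  have hbound (s : Set L) (hs : #s ≤ ℵ₀) : ∃ b, a < b ∧ ∀ y ∈ s, y < b :=
    hL.exists_gt_insert hμ₀ (hs.trans hμ₀) a
  have : Nonempty L := ⟨a⟩
  choose! B hBa hB using hbound
  let c : W → L := WellFoundedLT.fix fun w ih => B (Set.range fun w' : Set.Iio w => G (ih w'.1 w'.2))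
  have hcw (w : W) : c w = B (Set.range fun w' : Set.Iio w => G (c w'.1)) :=
    WellFoundedLT.fix_eq _ w
  have hcard (w : W) : #(Set.range fun w' : Set.Iio w => G (c w'.1)) ≤ ℵ₀ :=
    mk_range_le.trans ((mk_le_mk_of_subset Set.Iio_subset_Iic_self).trans (hW.mk_Iic_le w))
  have hca (w : W) : a < c w := by
    rw [hcw]; exact hBa _ (hcard w)
  have hcG {w' w : W} (h : w' < w) : G (c w') < c w := by
    rw [hcw w]; exact hB _ (hcard w) _ ⟨⟨w', h⟩, rfl⟩
  have hclt {w' w : W} (h : w' < w) : c w' < c w := (hG _).1.trans (hcG h)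
  have hex : {b | ∀ w, c w < b}.Nonempty := hL.exists_gt_range (hWcard.trans_le hμ) c
  let δ := WellFounded.min wellFounded_lt _ hex
  have hδ (w) : c w < δ := WellFounded.min_mem wellFounded_lt _ hex w
  have hlt {x : L} (hx : x < δ) : ∃ w, x ≤ c w := by
    by_contra! h
    exact WellFounded.not_lt_min wellFounded_lt {b | ∀ w, c w < b} h hx
  obtain ⟨w₀, -⟩ := hW.exists_gt ∅ (by simp)
  refine ⟨δ, (hca w₀).trans (hδ w₀), fun x hx => ?_, ⟨fun s hs hsδ => ?_, Set.range c, ?_, ?_, ?_⟩⟩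
  · obtain ⟨w, hw⟩ := hlt hx
    obtain ⟨w', hw'⟩ := hW.exists_gt {w} (by simp)
    exact ((hG _).2 _ hw).trans ((hcG (hw' w rfl)).trans (hδ _))
  · have : Nonempty W := ⟨w₀⟩
    choose! w hw using fun x hx => hlt (hsδ x hx)
    obtain ⟨w', hw'⟩ := hW.exists_gt (w '' s) (le_aleph0_iff_set_countable.2 (hs.image w))
    exact ⟨c w', hδ _, fun x hx => (hw x hx).trans_lt (hclt (hw' _ ⟨x, hx, rfl⟩))⟩
  · exact mk_range_le.trans hWcard.le
  · rintro _ ⟨w, rfl⟩; exact hδ w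
  · intro x hx
    obtain ⟨w, hw⟩ := hlt hx
    exact ⟨c w, ⟨w, rfl⟩, hw⟩

theorem MeetsClosurePoints.exists_fiber (hL : IsSuccLike L μ) {ι : Type u} (hι : #ι ≤ μ)
    {T : Set L} (hT : MeetsClosurePoints T) (c : L → ι) :
    ∃ i, MeetsClosurePoints {δ ∈ T | c δ = i} := by
  by_contra! h
  simp only [MeetsClosurePoints, not_forall] at h
  choose g hg using h
  choose G hG using fun x => hL.exists_gt_range hι fun i => g i x
  obtain ⟨δ, hδT, hδ⟩ := hT G
  exact hg (c δ) ⟨δ, ⟨hδT, rfl⟩, fun x hx => (hG x (c δ)).trans (hδ x hx)⟩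

/-- A set of cardinality at most `μ` in a well-order has at most `μ` limit points: each is a point
of the set, the supremum of the set, or the supremum of the part of the set below some point of it. -/
theorem mk_isLUB_le [WellFoundedLT L] (hμ : ℵ₀ ≤ μ) {Y : Set L} (hY : #Y ≤ μ) :
    #{β | ∃ Z ⊆ Y, IsLUB Z β} ≤ μ := by
  classical
  let s : Option Y → Set L := fun o => o.elim Y fun y => Y ∩ Set.Iio y.1
  rcases isEmpty_or_nonempty L with hL | ⟨⟨l₀⟩⟩
  · exact (by simp : #{β | ∃ Z ⊆ Y, IsLUB Z β} ≤ 0).trans zero_le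
  let t : Option Y → L := fun o => if h : ∃ β, IsLUB (s o) β then h.choose else l₀
  have ht {o β} (h : IsLUB (s o) β) : t o = β := by
    have h' : ∃ β, IsLUB (s o) β := ⟨β, h⟩
    simp only [t, dif_pos h']
    exact h'.choose_spec.unique h
  have hsub : {β | ∃ Z ⊆ Y, IsLUB Z β} ⊆ Y ∪ Set.range t := by
    rintro β ⟨Z, hZ, hβ⟩
    by_cases hβY : β ∈ Y
    · exact Or.inl hβY
    right
    by_cases h : ∃ y ∈ Y, β ≤ y
    · let y := WellFounded.min (wellFounded_lt (α := L)) {y | y ∈ Y ∧ β ≤ y} h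
      have hy : y ∈ Y ∧ β ≤ y := WellFounded.min_mem wellFounded_lt {y | y ∈ Y ∧ β ≤ y} h
      refine ⟨some ⟨y, hy.1⟩, ht ⟨fun x hx => ?_, fun b hb => hβ.2 fun z hz => hb ⟨hZ hz, ?_⟩⟩⟩
      · by_contra! hx'
        exact WellFounded.not_lt_min wellFounded_lt {y | y ∈ Y ∧ β ≤ y} ⟨hx.1, hx'.le⟩ hx.2
      · refine lt_of_le_of_ne ((hβ.1 hz).trans hy.2) fun hzy => hβY ?_
        have : β = y := le_antisymm hy.2 ((show z = y from hzy) ▸ hβ.1 hz)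
        exact this ▸ hy.1
    · push Not at h
      exact ⟨none, ht ⟨fun x hx => (h x hx).le, fun b hb => hβ.2 fun z hz => hb (hZ hz)⟩⟩
  refine (mk_le_mk_of_subset hsub).trans ((mk_union_le _ _).trans ?_)
  refine add_le_of_le hμ hY (mk_range_le.trans ?_)
  rw [mk_option]
  exact add_le_of_le hμ hY (one_le_aleph0.trans hμ)

end SuccLike

/-! ### A coherent system of sets and functions on `ω₃` -/

section Coherence

variable {Λ K : Type u} [LinearOrder Λ] [LinearOrder K]

/-- The part with index below `i` of the initial segment of `δ`, where `p δ β` is the index that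
`δ` assigns to `β < δ`. -/
def indexedPart (p : Λ → Λ → K) (i : K) (δ : Λ) : Set Λ := {β | β < δ ∧ p δ β < i}

/-- `D δ` is an unbounded subset of the initial segment of `δ` which is closed under suprema
of sequences, and on which `D` is coherent. -/
structure IsCoherentAt (D : Λ → Set Λ) (δ : Λ) : Prop where
  inter_eq : ∀ β ∈ D δ, D β = D δ ∩ Set.Iio β
  mem_of_isLUB : ∀ a : ℕ → Λ, (∀ n, a n ∈ D δ) → ∀ β < δ, IsLUB (Set.range a) β → β ∈ D δ
  exists_le : ∀ x < δ, ∃ y ∈ D δ, x ≤ y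

theorem mk_index_le {μ : Cardinal.{u}} (hK : IsSuccLike K μ) {p : Λ → Λ → K}
    (hp : ∀ δ, Set.InjOn (p δ) (Set.Iio δ)) (δ : Λ) (k : K) :
    #{β | β < δ ∧ p δ β ≤ k} ≤ μ := by
  refine le_trans ?_ (hK.mk_Iic_le k)
  refine mk_le_of_injective (f := fun β => ⟨p δ β.1, β.2.2⟩) fun β β' h => ?_
  exact Subtype.ext (hp δ β.2.1 β'.2.1 (congrArg Subtype.val h))

/-- At a point of cofinality `ω₁`, the index `i` only has to be a closure point of cofinality
`ω₁` of a suitable function: closure under this function gives coherence and puts all limit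
points of bounded parts into the set, and a sequence of indices below `i` is bounded below `i`. -/
theorem HasCofOmegaOne.exists_isCoherentAt [WellFoundedLT Λ] [WellFoundedLT K]
    (hK : IsSuccLike K ℵ₁) {p : Λ → Λ → K} (hp : ∀ δ, Set.InjOn (p δ) (Set.Iio δ)) {δ : Λ}
    (hδ : HasCofOmegaOne δ) : ∃ i, IsCoherentAt (indexedPart p i) δ := by
  let Y (β : Λ) (k : K) : Set Λ := {x | x < β ∧ p β x ≤ k}
  have hY (β k) : #(Y β k) ≤ ℵ₁ := mk_index_le hK hp β k
  have hℵ : ℵ₀ ≤ (ℵ₁ : Cardinal.{u}) := aleph0_lt_aleph_one.le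
  have hq (k : K) (β : Λ) : ∃ b, (∀ x ∈ Y β k, p δ x < b) ∧ ∀ x ∈ Y δ k, p β x < b := by
    obtain ⟨b, hb⟩ := hK.exists_gt (p δ '' Y β k ∪ p β '' Y δ k)
      ((mk_union_le _ _).trans (add_le_of_le hℵ (mk_image_le.trans (hY _ _))
        (mk_image_le.trans (hY _ _))))
    exact ⟨b, fun x hx => hb _ (Or.inl ⟨x, hx, rfl⟩), fun x hx => hb _ (Or.inr ⟨x, hx, rfl⟩)⟩
  choose q hq₁ hq₂ using hq
  have hφ (k : K) : ∃ b, (∀ β ∈ Y δ k, q k β < b) ∧ ∀ β, (∃ Z ⊆ Y δ k, IsLUB Z β) → p δ β < b := by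
    obtain ⟨b, hb⟩ := hK.exists_gt (q k '' Y δ k ∪ p δ '' {β | ∃ Z ⊆ Y δ k, IsLUB Z β})
      ((mk_union_le _ _).trans (add_le_of_le hℵ (mk_image_le.trans (hY _ _))
        (mk_image_le.trans (mk_isLUB_le hℵ (hY _ _)))))
    exact ⟨b, fun x hx => hb _ (Or.inl ⟨x, hx, rfl⟩), fun x hx => hb _ (Or.inr ⟨x, hx, rfl⟩)⟩
  choose φ hφ₁ hφ₂ using hφ
  obtain ⟨Z, hZ, hZδ, hZc⟩ := hδ.exists_cofinal
  obtain ⟨k₀, hk₀⟩ := hK.exists_gt (p δ '' Z) (mk_image_le.trans hZ)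
  obtain ⟨i, hi₀, hiφ, hi⟩ := hK.exists_closurePoint le_rfl φ k₀
  refine ⟨i, fun β hβ => ?_, fun a ha β hβ hlub => ⟨hβ, ?_⟩, fun x hx => ?_⟩
  · ext x
    constructor
    · rintro ⟨hxβ, hxi⟩
      refine ⟨⟨hxβ.trans hβ.1, ?_⟩, hxβ⟩
      have hk : max (p δ β) (p β x) < i := max_lt hβ.2 hxi
      exact (hq₁ _ β x ⟨hxβ, le_max_right (p δ β) _⟩).trans
        ((hφ₁ _ β ⟨hβ.1, le_max_left _ _⟩).trans (hiφ _ hk))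
    · rintro ⟨⟨hxδ, hxi⟩, hxβ⟩
      refine ⟨hxβ, ?_⟩
      have hk : max (p δ β) (p δ x) < i := max_lt hβ.2 hxi
      exact (hq₂ _ β x ⟨hxδ, le_max_right (p δ β) _⟩).trans
        ((hφ₁ _ β ⟨hβ.1, le_max_left _ _⟩).trans (hiφ _ hk))
  · obtain ⟨k, hki, hk⟩ := hi.exists_gt (Set.range fun n => p δ (a n)) (Set.countable_range _)
      (by rintro _ ⟨n, rfl⟩; exact (ha n).2)
    refine (hφ₂ k β ⟨Set.range a, ?_, hlub⟩).trans (hiφ k hki)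
    rintro _ ⟨n, rfl⟩
    exact ⟨(ha n).1, (hk _ ⟨n, rfl⟩).le⟩
  · obtain ⟨z, hz, hxz⟩ := hZc x hx
    exact ⟨z, ⟨hZδ z hz, (hk₀ _ ⟨z, hz, rfl⟩).trans hi₀⟩, hxz⟩

theorem exists_isCoherentAt [WellFoundedLT Λ] [WellFoundedLT K]
    (hΛ : IsSuccLike Λ (ℵ_ 2)) (hK : IsSuccLike K ℵ₁) (hcard : #K = ℵ_ 2) :
    ∃ (D : Λ → Set Λ) (T : Set Λ), MeetsClosurePoints T ∧ (∀ δ, D δ ⊆ Set.Iio δ) ∧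
      (∀ δ, #(D δ) ≤ ℵ₁) ∧ ∀ δ ∈ T, HasCofOmegaOne δ ∧ IsCoherentAt D δ := by
  have hp (δ : Λ) : ∃ f : Λ → K, Set.InjOn f (Set.Iio δ) := by
    have h : #(Set.Iio δ) ≤ #K :=
      ((mk_le_mk_of_subset Set.Iio_subset_Iic_self).trans (hΛ.mk_Iic_le δ)).trans_eq hcard.symm
    obtain ⟨f⟩ := h
    obtain ⟨k₀, -⟩ := hK.exists_gt ∅ (by simp)
    classical
    refine ⟨fun x => if h : x < δ then f ⟨x, h⟩ else k₀, fun x hx y hy h => ?_⟩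
    simp only [dif_pos (Set.mem_Iio.1 hx), dif_pos (Set.mem_Iio.1 hy)] at h
    exact congrArg Subtype.val (f.injective h)
  choose p hp using hp
  have hstat : MeetsClosurePoints {δ : Λ | HasCofOmegaOne δ} := fun g => by
    obtain ⟨a, -⟩ := hΛ.exists_gt ∅ (by simp)
    obtain ⟨δ, -, hδg, hδ⟩ := hΛ.exists_closurePoint (aleph_le_aleph.2 one_le_two) g a
    exact ⟨δ, hδ, hδg⟩
  have hi (δ : Λ) : ∃ i, HasCofOmegaOne δ → IsCoherentAt (indexedPart p i) δ := by
    by_cases h : HasCofOmegaOne δ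
    · exact (h.exists_isCoherentAt hK hp).imp fun i hi _ => hi
    · obtain ⟨k₀, -⟩ := hK.exists_gt ∅ (by simp)
      exact ⟨k₀, fun h' => absurd h' h⟩
  choose c hc using hi
  obtain ⟨i, hi⟩ := hstat.exists_fiber hΛ hcard.le c
  refine ⟨indexedPart p i, _, hi, fun δ β hβ => hβ.1, fun δ => ?_, ?_⟩
  · have hsub : indexedPart p i δ ⊆ {β | β < δ ∧ p δ β ≤ i} := fun β hβ => ⟨hβ.1, hβ.2.le⟩
    exact (mk_le_mk_of_subset hsub).trans (mk_index_le hK hp δ i)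
  · rintro δ ⟨hδ, rfl⟩
    exact ⟨hδ, hc δ hδ⟩

/-- A rank function with values in `K` for the relation `β ∈ D δ`. -/
theorem exists_rank [WellFoundedLT Λ] [WellFoundedLT K] {μ : Cardinal.{u}} (hK : IsSuccLike K μ)
    {D : Λ → Set Λ} (hD : ∀ δ, D δ ⊆ Set.Iio δ) (hcard : ∀ δ, #(D δ) ≤ μ) :
    ∃ ρ : Λ → K, ∀ δ, (∀ β ∈ D δ, ρ β < ρ δ) ∧ ∀ ξ < ρ δ, ∃ β ∈ D δ, ξ ≤ ρ β := by
  have hex (δ : Λ) (f : Set.Iio δ → K) : {b | ∀ β : D δ, f ⟨β.1, hD δ β.2⟩ < b}.Nonempty :=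
    hK.exists_gt_range (hcard δ) fun β : D δ => f ⟨β.1, hD δ β.2⟩
  let F (δ : Λ) (f : Set.Iio δ → K) : K := WellFounded.min wellFounded_lt _ (hex δ f)
  let ρ : Λ → K := WellFoundedLT.fix fun δ ih => F δ fun β => ih β.1 β.2
  have hρ (δ : Λ) : ρ δ = F δ fun β => ρ β.1 := WellFoundedLT.fix_eq _ δ
  refine ⟨ρ, fun δ => ⟨fun β hβ => ?_, fun ξ hξ => ?_⟩⟩
  · rw [hρ δ]
    exact WellFounded.min_mem wellFounded_lt _ (hex δ fun β => ρ β.1) ⟨β, hβ⟩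
  · by_contra! h
    rw [hρ δ] at hξ
    exact WellFounded.not_lt_min wellFounded_lt {b | ∀ β : D δ, ρ β.1 < b} (fun β => h β.1 β.2) hξ

/-- The limits of cofinality `ω` that belong to the sets `D δ` with `δ ∈ T`. -/
def ladderPoints (D : Λ → Set Λ) (T : Set Λ) : Set Λ :=
  {γ | (∃ δ ∈ T, γ ∈ D δ) ∧ ∃ a : ℕ → Λ, StrictMono a ∧ IsLUB (Set.range a) γ}

theorem meetsClosurePoints_ladderPoints [WellFoundedLT Λ] {μ : Cardinal.{u}} (hμ : ℵ₀ ≤ μ)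
    (hΛ : IsSuccLike Λ μ) {D : Λ → Set Λ} {T : Set Λ} (hT : MeetsClosurePoints T)
    (hD : ∀ δ, D δ ⊆ Set.Iio δ)
    (hTD : ∀ δ ∈ T, HasCofOmegaOne δ ∧ IsCoherentAt D δ) :
    MeetsClosurePoints (ladderPoints D T) := by
  intro g
  obtain ⟨G, hG⟩ := hΛ.exists_majorant hμ g
  obtain ⟨δ, hδT, hδG⟩ := hT G
  obtain ⟨hδ, hDδ⟩ := hTD δ hδT
  have hnext (x : D δ) : ∃ y : D δ, G x.1 ≤ y.1 := by
    obtain ⟨y, hy, hxy⟩ := hDδ.exists_le (G x.1) (hδG _ (hD δ x.2))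
    exact ⟨⟨y, hy⟩, hxy⟩
  choose next hnext using hnext
  obtain ⟨b, hb, -⟩ := hδ.exists_gt ∅ Set.countable_empty (by simp)
  obtain ⟨y₀, hy₀, -⟩ := hDδ.exists_le b hb
  let a (n : ℕ) : D δ := next^[n] ⟨y₀, hy₀⟩
  have ha (n : ℕ) : G (a n).1 ≤ (a (n + 1)).1 := by
    simp only [a, Function.iterate_succ_apply']
    exact hnext _
  have hmono : StrictMono fun n => (a n).1 :=
    strictMono_nat_of_lt_succ fun n => (hG _).1.trans_le (ha n)
  obtain ⟨b', hb'δ, hb'⟩ := hδ.exists_gt (Set.range fun n => (a n).1) (Set.countable_range _)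
    (by rintro _ ⟨n, rfl⟩; exact hD δ (a n).2)
  have hub : (upperBounds (Set.range fun n => (a n).1)).Nonempty := ⟨b', fun x hx => (hb' x hx).le⟩
  let γ := WellFounded.min wellFounded_lt _ hub
  have hγ : IsLUB (Set.range fun n => (a n).1) γ :=
    ⟨WellFounded.min_mem wellFounded_lt _ hub,
      fun b hb => not_lt.1 (WellFounded.not_lt_min wellFounded_lt (upperBounds _) hb)⟩
  have hγδ : γ < δ := (hγ.2 fun x hx => (hb' x hx).le).trans_lt hb'δ
  refine ⟨γ, ⟨⟨δ, hδT, hDδ.mem_of_isLUB _ (fun n => (a n).2) γ hγδ hγ⟩, _, hmono, hγ⟩,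
    fun x hx => ?_⟩
  obtain ⟨_, ⟨n, rfl⟩, hxn⟩ := (lt_isLUB_iff hγ).1 hx
  exact ((hG _).2 _ hxn.le).trans_le ((ha n).trans (hγ.1 ⟨n + 1, rfl⟩))

open Classical in
/-- The least point of `A` above `i` (and `i` itself if there is none). -/
noncomputable def nextPoint [WellFoundedLT Λ] (A : Set Λ) (i : Λ) : Λ :=
  if h : {y | y ∈ A ∧ i < y}.Nonempty then WellFounded.min wellFounded_lt _ h else i

theorem nextPoint_eq [WellFoundedLT Λ] {A : Set Λ} {i m : Λ} (hm : m ∈ A) (him : i < m)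
    (h : ∀ y ∈ A, i < y → m ≤ y) : nextPoint A i = m := by
  have hne : {y | y ∈ A ∧ i < y}.Nonempty := ⟨m, hm, him⟩
  have hmem := WellFounded.min_mem (wellFounded_lt (α := Λ)) _ hne
  rw [nextPoint, dif_pos hne]
  exact le_antisymm (not_lt.1 (WellFounded.not_lt_min wellFounded_lt {y | y ∈ A ∧ i < y}
    ⟨hm, him⟩)) (h _ hmem.1 hmem.2)

theorem nextPoint_spec [WellFoundedLT Λ] {A : Set Λ} {i x : Λ} (hx : x ∈ A) (hix : i < x) :
    nextPoint A i ∈ A ∧ i < nextPoint A i ∧ ∀ y ∈ A, i < y → nextPoint A i ≤ y := by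
  have hne : {y | y ∈ A ∧ i < y}.Nonempty := ⟨x, hx, hix⟩
  have hmem := WellFounded.min_mem (wellFounded_lt (α := Λ)) _ hne
  rw [nextPoint, dif_pos hne]
  exact ⟨hmem.1, hmem.2, fun y hy hiy =>
    not_lt.1 (WellFounded.not_lt_min wellFounded_lt {y | y ∈ A ∧ i < y} ⟨hy, hiy⟩)⟩

/-- A coherent system of functions `h δ`, the next-point functions of sets which are unbounded
in `δ ∈ T` but avoid a stationary set `E` of limits `γ` of ladders `η γ`: when `γ ∈ E` lies below
`δ ∈ T`, the function `h δ` jumps over `γ` from almost all points of the ladder. -/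
theorem exists_coherent_jumps [WellFoundedLT Λ] [WellFoundedLT K]
    (hΛ : IsSuccLike Λ (ℵ_ 2)) (hK : IsSuccLike K ℵ₁) (hcard : #K = ℵ_ 2) :
    ∃ (E T : Set Λ) (η : Λ → ℕ → Λ) (h : Λ → Λ → Λ),
      MeetsClosurePoints E ∧ (∀ γ ∈ E, ∀ n, η γ n < γ) ∧ MeetsClosurePoints T ∧
      (∀ δ ∈ T, ∀ s : Set Λ, s.Countable → (∀ x ∈ s, x < δ) →
        ∃ γ < δ, (∀ x ∈ s, x < γ) ∧ ∀ i < γ, h γ i = h δ i) ∧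
      ∀ δ ∈ T, ∀ γ ∈ E, γ < δ → {n | h δ (η γ n) < γ}.Finite := by
  have hℵ : ℵ₀ ≤ (ℵ_ 2 : Cardinal.{u}) := aleph0_le_aleph 2
  obtain ⟨D, T₀, hT₀, hD, hDcard, hTD⟩ := exists_isCoherentAt hΛ hK hcard
  obtain ⟨ρ, hρ⟩ := exists_rank hK hD hDcard
  obtain ⟨r, hT⟩ := hT₀.exists_fiber hΛ hcard.le ρ
  obtain ⟨ξ, hE⟩ := (meetsClosurePoints_ladderPoints hℵ hΛ hT hD
    fun δ hδ => hTD δ hδ.1).exists_fiber hΛ hcard.le ρ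
  have hξr : ξ < r := by
    obtain ⟨γ, ⟨⟨⟨δ, hδ, hγδ⟩, -⟩, hγ⟩, -⟩ := hE id
    rw [← hγ, ← hδ.2]
    exact (hρ δ).1 γ hγδ
  choose! η hηmono hηlub using fun γ (hγ : γ ∈ ladderPoints D {δ ∈ T₀ | ρ δ = r}) => hγ.2
  -- Removing the points of rank at most `ξ` makes all limits of the set have rank above `ξ`.
  let D' (δ : Λ) : Set Λ := {β | β ∈ D δ ∧ ξ < ρ β}
  have hD' {δ} (hδ : δ ∈ {δ ∈ T₀ | ρ δ = r}) {x} (hx : x < δ) : ∃ y ∈ D' δ, x < y := by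
    obtain ⟨hω, hDδ⟩ := hTD δ hδ.1
    obtain ⟨γ, hγ, hξγ⟩ := (hρ δ).2 ξ (hξr.trans_eq hδ.2.symm)
    obtain ⟨b, hbδ, hb⟩ := hω.exists_gt {x, γ} ((Set.countable_singleton _).insert _)
      (by rintro y (rfl | rfl); exacts [hx, hD δ hγ])
    obtain ⟨y, hy, hby⟩ := hDδ.exists_le b hbδ
    refine ⟨y, ⟨hy, hξγ.trans_lt ((hρ y).1 γ ?_)⟩, (hb x (by simp)).trans_le hby⟩
    rw [hDδ.inter_eq y hy]
    exact ⟨hγ, (hb γ (by simp)).trans_le hby⟩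
  refine ⟨_, _, η, fun δ => nextPoint (insert δ (D' δ)), hE, fun γ hγ n => ?_, hT, ?_, ?_⟩
  · exact (hηmono γ hγ.1 n.lt_succ_self).trans_le ((hηlub γ hγ.1).1 ⟨n + 1, rfl⟩)
  · intro δ hδ s hs hsδ
    obtain ⟨b, hbδ, hb⟩ := (hTD δ hδ.1).1.exists_gt s hs hsδ
    obtain ⟨γ, hγ, hbγ⟩ := hD' hδ hbδ
    refine ⟨γ, hD δ hγ.1, fun x hx => (hb x hx).trans hbγ, fun i hi => ?_⟩
    obtain ⟨h₁, h₂, h₃⟩ := nextPoint_spec (A := insert δ (D' δ)) (Set.mem_insert_of_mem δ hγ) hi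
    have hle := h₃ γ (Set.mem_insert_of_mem δ hγ) hi
    have hγδ : γ < δ := hD δ hγ.1
    have hDγ := (hTD δ hδ.1).2.inter_eq γ hγ.1
    refine nextPoint_eq ?_ h₂ ?_
    · rcases hle.eq_or_lt with heq | hlt
      · exact Or.inl heq
      · rcases h₁ with h₁ | h₁
        · exact absurd (h₁ ▸ hle) (not_le.2 hγδ)
        · exact Or.inr ⟨hDγ ▸ ⟨h₁.1, hlt⟩, h₁.2⟩
    · rintro y (rfl | hy) hiy
      · exact hle
      · exact h₃ y (Or.inr ⟨(hDγ ▸ hy.1 : y ∈ D δ ∩ Set.Iio γ).1, hy.2⟩) hiy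
  · intro δ hδ γ hγ hγδ
    obtain ⟨-, hDδ⟩ := hTD δ hδ.1
    have hbdd : ∃ x < γ, ∀ y ∈ D' δ, x < y → γ ≤ y := by
      by_contra! hcon
      have hηlt (n : ℕ) : η γ n < γ :=
        (hηmono γ hγ.1 n.lt_succ_self).trans_le ((hηlub γ hγ.1).1 ⟨n + 1, rfl⟩)
      choose y hy hlt hyγ using fun n => hcon (η γ n) (hηlt n)
      have hlub : IsLUB (Set.range y) γ := by
        refine ⟨?_, fun b hb => (hηlub γ hγ.1).2 ?_⟩
        · rintro _ ⟨n, rfl⟩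
          exact (hyγ n).le
        · rintro _ ⟨n, rfl⟩
          exact (hlt n).le.trans (hb ⟨n, rfl⟩)
      have hγD : γ ∈ D δ := hDδ.mem_of_isLUB y (fun n => (hy n).1) γ hγδ hlub
      have hy₀ : y 0 ∈ D γ := by
        rw [hDδ.inter_eq γ hγD]
        exact ⟨(hy 0).1, hyγ 0⟩
      have := (hρ γ).1 _ hy₀
      rw [hγ.2] at this
      exact lt_asymm this (hy 0).2
    obtain ⟨x, hxγ, hx⟩ := hbdd
    obtain ⟨_, ⟨N, rfl⟩, hN⟩ := (lt_isLUB_iff (hηlub γ hγ.1)).1 hxγ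
    refine (Set.finite_lt_nat N).subset fun n hn => ?_
    by_contra hNn
    have hNn' : N ≤ n := not_lt.1 hNn
    have hxn : x < η γ n := hN.trans_le ((hηmono γ hγ.1).monotone hNn')
    have hnγ : η γ n < γ := (hηmono γ hγ.1 n.lt_succ_self).trans_le
      ((hηlub γ hγ.1).1 ⟨n + 1, rfl⟩)
    obtain ⟨h₁, h₂, -⟩ := nextPoint_spec (A := insert δ (D' δ)) (Set.mem_insert δ _)
      (hnγ.trans hγδ)
    refine absurd hn (not_lt.2 ?_)
    rcases h₁ with h₁ | h₁
    · exact hγδ.le.trans_eq h₁.symm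
    · exact hx _ h₁ (hxn.trans h₂)

end Coherence

/-! ### Structures that code finite parity conditions -/

/-- A node of the structures that code systems of conditions on sets of variables `v : V`. The
labels are rigid and name the variables and the conditions; a variable has two values; a
condition `e : Q` has a node for each finite set of variables. -/
inductive Node (V Q : Type u) : Type u
  | label (l : V ⊕ Q)
  | var (v : V) (b : Bool)
  | eqn (e : Q) (X : Finset V)

section System

variable {V Q : Type u}

open Classical in
/-- The binary predicate on nodes. Labels are well-ordered and adjacent to the nodes that they name,
other nodes have loops, `(v, b)` is adjacent to `(e, X)` when `v` occurs in `e` and `b` says whether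
`v ∈ X`, and `(e, X)` is adjacent back to its label when `mark e` holds of the number of elements of
`X` that occur in `e`. -/
def Node.Rel (S : Q → Set V) (mark : Q → ℕ → Prop) : Node V Q → Node V Q → Prop
  | label l, label l' => WellOrderingRel l l'
  | label l, var v _ => l = Sum.inl v
  | label l, eqn e _ => l = Sum.inr e
  | var v b, var w c => v = w ∧ b = c
  | var v b, eqn e X => v ∈ S e ∧ (b = true ↔ v ∈ X)
  | eqn e X, eqn e' X' => e = e' ∧ X = X'
  | eqn e X, label l => l = Sum.inr e ∧ mark e (X.filter (· ∈ S e)).card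
  | var _ _, label _ => False
  | eqn _ _, var _ _ => False

/-- The type of nodes, as the domain of the structure with predicate `Node.Rel S mark`. -/
def NodeStructure (_S : Q → Set V) (_mark : Q → ℕ → Prop) : Type u :=
  Node V Q

instance (S : Q → Set V) (mark : Q → ℕ → Prop) :
    binaryLanguage.Structure (NodeStructure S mark) where
  funMap := fun f => nomatch f
  RelMap := fun r => match r with
    | BinaryRel.rel => fun t => Node.Rel S mark (t 0) (t 1)

theorem isPartialIso_iff {S : Q → Set V} {mA mB : Q → ℕ → Prop}
    {π : Set (NodeStructure S mA × NodeStructure S mB)} :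
    IsPartialIso binaryLanguage π ↔ (∀ p ∈ π, ∀ q ∈ π, p.1 = q.1 ↔ p.2 = q.2) ∧
      ∀ p ∈ π, ∀ q ∈ π, Node.Rel S mA p.1 q.1 ↔ Node.Rel S mB p.2 q.2 := by
  refine ⟨fun h => ⟨h.eq_iff, fun p hp q hq => ?_⟩, fun h => ⟨h.1, fun n R t ht => ?_⟩⟩
  · refine h.rel_iff 2 BinaryRel.rel ![p, q] fun i => ?_
    fin_cases i
    exacts [hp, hq]
  · cases R
    exact h.2 _ (ht 0) _ (ht 1)

open Classical in
/-- The finite set of variables of `e` that belong to `F` (empty when this set is infinite). -/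
noncomputable def flipSet (S : Q → Set V) (F : Set V) (e : Q) : Finset V :=
  if h : (F ∩ S e).Finite then h.toFinset else ∅

open Classical in
/-- Exchange the two values of the variables in `F`. -/
noncomputable def Node.flip (S : Q → Set V) (F : Set V) : Node V Q → Node V Q
  | label l => label l
  | var v b => var v (b ^^ decide (v ∈ F))
  | eqn e X => eqn e (symmDiff X (flipSet S F e))

open Classical in
/-- `F` satisfies the condition `e`: it contains finitely many variables of `e`, and exchanging their
membership carries marked sets for `mA` to marked sets for `mB`. -/
structure Solves (S : Q → Set V) (mA mB : Q → ℕ → Prop) (F : Set V) (e : Q) : Prop where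
  finite : (F ∩ S e).Finite
  mark_iff : ∀ X : Finset V, mA e (X.filter (· ∈ S e)).card ↔
    mB e ((symmDiff X (flipSet S F e)).filter (· ∈ S e)).card

theorem Solves.mem_flipSet {S : Q → Set V} {mA mB : Q → ℕ → Prop} {F : Set V} {e : Q}
    (h : Solves S mA mB F e) {v : V} : v ∈ flipSet S F e ↔ v ∈ F ∧ v ∈ S e := by
  simp [flipSet, dif_pos h.finite]

theorem Node.flip_flip (S : Q → Set V) (F : Set V) (n : Node V Q) :
    (n.flip S F).flip S F = n := by
  classical
  cases n with
  | label l => rfl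
  | var v b => simp [Node.flip]
  | eqn e X =>
    refine congrArg (eqn e) (Finset.ext fun v => ?_)
    simp only [Finset.mem_symmDiff]
    tauto

/-- The node `n` is not a node of a condition that `F` violates. -/
def Node.IsSolved (S : Q → Set V) (mA mB : Q → ℕ → Prop) (F : Set V) : Node V Q → Prop
  | label _ => True
  | var _ _ => True
  | eqn e _ => Solves S mA mB F e

theorem Node.rel_flip_iff {S : Q → Set V} {mA mB : Q → ℕ → Prop} {F : Set V} {m n : Node V Q}
    (hm : m.IsSolved S mA mB F) (hn : n.IsSolved S mA mB F) :
    Node.Rel S mA m n ↔ Node.Rel S mB (m.flip S F) (n.flip S F) := by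
  classical
  cases m with
  | label l => cases n <;> simp [Node.flip, Node.Rel]
  | var v b =>
    cases n with
    | label l => simp [Node.flip, Node.Rel]
    | var w c =>
      simp only [Node.flip, Node.Rel]
      refine and_congr_right fun h => ?_
      subst h
      simp
    | eqn e X =>
      simp only [Node.flip, Node.Rel]
      refine and_congr_right fun h => ?_
      have hv : v ∈ flipSet S F e ↔ v ∈ F := by
        rw [Solves.mem_flipSet hn]; exact and_iff_left h
      rw [Finset.mem_symmDiff, hv]
      by_cases hF : v ∈ F <;> by_cases hX : v ∈ X <;> cases b <;> simp [hF, hX]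
  | eqn e X =>
    cases n with
    | label l =>
      simp only [Node.flip, Node.Rel]
      exact and_congr_right fun _ => Solves.mark_iff hm X
    | var w c => simp [Node.flip, Node.Rel]
    | eqn e' X' =>
      simp only [Node.flip, Node.Rel]
      refine and_congr_right fun h => ?_
      subst h
      simp

/-- Flipping the variables in `F` is a partial isomorphism on the nodes whose conditions
are solved by `F`. -/
theorem isPartialIso_flip {S : Q → Set V} {mA mB : Q → ℕ → Prop} {F : Set V}
    {π : Set (NodeStructure S mA × NodeStructure S mB)}
    (hπ : ∀ p ∈ π, p.2 = Node.flip S F p.1 ∧ Node.IsSolved S mA mB F p.1) :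
    IsPartialIso binaryLanguage π := by
  refine isPartialIso_iff.2 ⟨fun p hp q hq => ?_, fun p hp q hq => ?_⟩
  · rw [(hπ p hp).1, (hπ q hq).1]
    exact (Function.LeftInverse.injective (Node.flip_flip S F)).eq_iff.symm
  · rw [(hπ p hp).1, (hπ q hq).1]
    exact Node.rel_flip_iff (hπ p hp).2 (hπ q hq).2

end System

/-! ### Runs, and the strategies of `∀` -/

section Runs

variable {A B : Type u} {γ : Ordinal.{v}}

/-- A rule that determines each round from the preceding ones determines a run. -/
theorem exists_run (step : ∀ β : Set.Iio γ, Run A B β.1 → Move A B × Move A B) :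
    ∃ p : Run A B γ, ∀ β, p β = step β (p.before β) := by
  let p : Run A B γ := WellFoundedLT.fix fun β ih =>
    step β fun δ => ih ⟨δ.1, lt_trans (Set.mem_Iio.1 δ.2) β.2⟩ δ.2
  exact ⟨p, fun β => WellFoundedLT.fix_eq _ β⟩

theorem Run.before_congr {p q : Run A B γ} {β : Set.Iio γ} (h : ∀ δ < β, p δ = q δ) :
    p.before β = q.before β :=
  funext fun δ => h ⟨δ.1, _⟩ δ.2

end Runs

theorem countable_Iio_of_lt_omega_one {β : Ordinal.{v}} (h : β < ω_ 1) : Countable (Set.Iio β) := by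
  rw [← mk_le_aleph0_iff, Cardinal.mk_Iio_ordinal, lift_le_aleph0, ← Order.lt_succ_iff, succ_aleph0, ← lt_ord,
    ord_aleph]
  exact h

section Forall

variable {V Q Λ : Type u} [LinearOrder Λ] {S : Q → Set V} {mA mB : Q → ℕ → Prop}

/-- The index of a node (that of a label is irrelevant and set to `l₀`). -/
def Node.index (iV : V → Λ) (iQ : Q → Λ) (l₀ : Λ) : Node V Q → Λ
  | label _ => l₀
  | var v _ => iV v
  | eqn e _ => iQ e

theorem Node.flip_congr {iV : V → Λ} {iQ : Q → Λ} (hS : ∀ e, ∀ v ∈ S e, iV v ≤ iQ e)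
    {F F' : Set V} {γ : Λ} (hF : ∀ v, iV v < γ → (v ∈ F ↔ v ∈ F')) {l₀ : Λ} {n : Node V Q}
    (hn : n.index iV iQ l₀ < γ) : n.flip S F = n.flip S F' := by
  cases n with
  | label l => rfl
  | var v b =>
    refine congrArg (fun c => var v (b ^^ c)) ?_
    exact decide_eq_decide.2 (hF v hn)
  | eqn e X =>
    have h : F ∩ S e = F' ∩ S e := by
      ext v
      exact and_congr_left fun hv => hF v ((hS e v hv).trans_lt hn)
    have h' : flipSet S F e = flipSet S F' e := by unfold flipSet; rw [h]
    simp only [Node.flip, h']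

/-- Player `∃` answers by flipping the variables in `F`. -/
noncomputable def flipMove (S : Q → Set V) (mA mB : Q → ℕ → Prop) (F : Set V) :
    Move (NodeStructure S mA) (NodeStructure S mB) →
      Move (NodeStructure S mA) (NodeStructure S mB)
  | Sum.inl a => Sum.inr (Node.flip S F a)
  | Sum.inr b => Sum.inl (Node.flip S F b)

/-- The node played in a move. -/
def moveNode : Move (NodeStructure S mA) (NodeStructure S mB) → Node V Q
  | Sum.inl a => a
  | Sum.inr b => b

/-- Player `∀` does not win when there are sets `F δ` of variables, for `δ` in a stationary set `T` of
points of uncountable cofinality, such that `F δ` solves all conditions of index below `δ`, and the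
initial parts of `F δ` occur as initial parts of sets `F γ` with `γ < δ`. A strategy of `∀` is played
against the answers given by each `F γ`. If `δ ∈ T` is closed under the function that bounds
the indices of the moves against `F γ`, then the moves against `F δ` have indices below `δ`:
before each of its rounds the run against `F δ` agrees with the run against some `F γ` with `γ < δ`. -/
theorem not_forallWins (hΛ : IsSuccLike Λ (ℵ_ 2)) {iV : V → Λ} {iQ : Q → Λ}
    (hS : ∀ e, ∀ v ∈ S e, iV v ≤ iQ e) {T : Set Λ} (hT : MeetsClosurePoints T) {F : Λ → Set V}
    (hF : ∀ δ ∈ T, ∀ s : Set Λ, s.Countable → (∀ x ∈ s, x < δ) →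
        ∃ γ < δ, (∀ x ∈ s, x < γ) ∧ ∀ v, iV v < γ → (v ∈ F γ ↔ v ∈ F δ))
    (hsol : ∀ δ ∈ T, ∀ e, iQ e < δ → Solves S mA mB (F δ) e) :
    ¬ ForallWins binaryLanguage (NodeStructure S mA) (NodeStructure S mB)
      (ω_ 1 : Ordinal.{0}) := by
  rintro ⟨τ, hτ⟩
  obtain ⟨l₀, -⟩ := hΛ.exists_gt ∅ (by simp)
  choose p hp using fun γ : Λ => exists_run (γ := (ω_ 1 : Ordinal.{0})) fun β q =>
    (τ β q, flipMove S mA mB (F γ) (τ β q))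
  have hp₁ (γ β) : (p γ β).1 = τ β ((p γ).before β) := by rw [hp]
  have hp₂ (γ β) : (p γ β).2 = flipMove S mA mB (F γ) (p γ β).1 := by rw [hp]
  let idx (γ : Λ) (β : Set.Iio (ω_ 1 : Ordinal.{0})) : Λ :=
    (moveNode (p γ β).1).index iV iQ l₀
  have hg (γ : Λ) : ∃ b, ∀ β, idx γ β < b := by
    obtain ⟨b, hb⟩ := hΛ.exists_gt (Set.range (idx γ)) (by
      have h := mk_range_le_lift (f := idx γ)
      rw [Cardinal.mk_Iio_ordinal, card_omega] at h
      have h' : lift.{1} #(Set.range (idx γ)) ≤ lift.{1} (ℵ_ 2) := by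
        refine h.trans ?_
        simp
      exact lift_le.1 h')
    exact ⟨b, fun β => hb _ ⟨β, rfl⟩⟩
  choose g hg using hg
  obtain ⟨δ, hδT, hδg⟩ := hT g
  have hidx (β) : idx δ β < δ := by
    induction β using WellFoundedLT.induction with
    | ind β ih =>
      have : Countable (Set.Iio β) := by
        have := countable_Iio_of_lt_omega_one β.2
        exact Function.Injective.countable (f := fun x : Set.Iio β => (⟨x.1.1, x.2⟩ : Set.Iio β.1))
          fun x y h => Subtype.ext (Subtype.ext (Subtype.mk.inj h))
      obtain ⟨γ, hγδ, hγ, hFγ⟩ := hF δ hδT (idx δ '' Set.Iio β) (Set.Countable.image this _)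
        (by rintro _ ⟨β', hβ', rfl⟩; exact ih β' hβ')
      have hagree (β') (hβ' : β' < β) : p γ β' = p δ β' := by
        induction β' using WellFoundedLT.induction with
        | ind β' ih' =>
          have h₁ : (p γ β').1 = (p δ β').1 := by
            rw [hp₁, hp₁, Run.before_congr fun ε hε => ih' ε hε (hε.trans hβ')]
          refine Prod.ext h₁ ?_
          have hlt : idx δ β' < γ := hγ _ ⟨β', hβ', rfl⟩
          rw [hp₂, hp₂, h₁]
          simp only [idx] at hlt
          cases hm : (p δ β').1 with
          | inl a =>
            rw [hm] at hlt
            exact congrArg Sum.inr (Node.flip_congr hS hFγ hlt)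
          | inr b =>
            rw [hm] at hlt
            exact congrArg Sum.inl (Node.flip_congr hS hFγ hlt)
      have hβ : (p γ β).1 = (p δ β).1 := by
        rw [hp₁, hp₁, Run.before_congr hagree]
      have heq : idx γ β = idx δ β := by simp only [idx, hβ]
      rw [← heq]
      exact (hg γ β).trans (hδg γ hγδ)
  have hsolved (β) : (moveNode (p δ β).1).IsSolved S mA mB (F δ) := by
    have h := hidx β
    simp only [idx] at h
    cases hm : moveNode (p δ β).1 with
    | label l => trivial
    | var v b => trivial
    | eqn e X =>
      rw [hm] at h
      exact hsol δ hδT e h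
  refine hτ (p δ) (hp₁ δ) ⟨fun β => ?_, isPartialIso_flip (F := F δ) ?_⟩
  · rw [hp₂]
    cases (p δ β).1
    exacts [Or.inl ⟨rfl, rfl⟩, Or.inr ⟨rfl, rfl⟩]
  · rintro ⟨a, b⟩ ⟨β, h | h⟩
    · have h₁ : (p δ β).1 = Sum.inl a := by rw [h]
      have h₂ : (p δ β).2 = Sum.inr b := by rw [h]
      have hs := hsolved β
      rw [hp₂, h₁] at h₂
      rw [h₁] at hs
      exact ⟨(Sum.inr.inj h₂).symm, hs⟩
    · have h₁ : (p δ β).1 = Sum.inr b := by rw [h]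
      have h₂ : (p δ β).2 = Sum.inl a := by rw [h]
      have hs := hsolved β
      rw [hp₂, h₁] at h₂
      rw [h₁] at hs
      obtain rfl : Node.flip S (F δ) b = a := Sum.inl.inj h₂
      refine ⟨(Node.flip_flip S (F δ) b).symm, ?_⟩
      revert hs
      cases b <;> exact id

end Forall

/-! ### Winning strategies of `∃` as back-and-forth systems -/

section Positions

variable (L : FirstOrder.Language.{0, 0})
variable {A B : Type u} [L.Structure A] [L.Structure B]

/-- A back-and-forth system of positions `q : P`, with partial isomorphisms `π q`, that is closed
under limits of increasing sequences. -/
structure IsWinningSystem {P : Type v} [Preorder P] (π : P → Set (A × B)) : Prop where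
  mono : Monotone π
  isPartialIso : ∀ q, IsPartialIso L (π q)
  forth : ∀ q a, ∃ q' b, q ≤ q' ∧ (a, b) ∈ π q'
  back : ∀ q b, ∃ q' a, q ≤ q' ∧ (a, b) ∈ π q'
  exists_ub : ∀ s : ℕ → P, Monotone s → ∃ q, ∀ n, s n ≤ q

variable {L}

/-- The positions are the countable initial parts of runs against the winning strategy. A position
is encoded by its length together with a complete sequence of moves of `∀`; only the moves
before the length matter. -/
theorem ExistsWins.exists_isWinningSystem [Nonempty A]
    (h : ExistsWins L A B (ω_ 1 : Ordinal.{0})) :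
    ∃ (P : Type (max u 1)) (_ : Preorder P) (π : P → Set (A × B)), Nonempty P ∧
      IsWinningSystem L π := by
  obtain ⟨τ, hτ⟩ := h
  let I : Type 1 := Set.Iio (ω_ 1 : Ordinal.{0})
  choose p hp using fun x : I → Move A B => exists_run (γ := (ω_ 1 : Ordinal.{0})) fun β q =>
    (x β, τ β q (x β))
  have hwin (x) : (p x).WonByExists L := hτ (p x) fun β => by rw [hp]
  have hcongr {x x' : I → Move A B} {β : I} (hx : ∀ ε < β, x ε = x' ε) (ε) (hε : ε < β) :
      p x ε = p x' ε := by
    induction ε using WellFoundedLT.induction with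
    | ind ε ih =>
      rw [hp, hp, hx ε hε, Run.before_congr fun ζ hζ => ih ζ hζ (hζ.trans hε)]
  let π : (I → Move A B) × I → Set (A × B) := fun q =>
    {ab | ∃ β < q.2, p q.1 β = (Sum.inl ab.1, Sum.inr ab.2) ∨
      p q.1 β = (Sum.inr ab.2, Sum.inl ab.1)}
  let pre : Preorder ((I → Move A B) × I) :=
    { le := fun q q' => q.2 ≤ q'.2 ∧ ∀ ε < q.2, q.1 ε = q'.1 ε
      le_refl := fun q => ⟨le_rfl, fun _ _ => rfl⟩
      le_trans := fun q q' q'' h h' => ⟨h.1.trans h'.1, fun ε hε =>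
        (h.2 ε hε).trans (h'.2 ε (hε.trans_le h.1))⟩ }
  have hsucc (β : I) : β.1 + 1 ∈ Set.Iio (ω_ 1 : Ordinal.{0}) :=
    (isSuccLimit_omega 1).succ_lt β.2
  have hzero : (0 : Ordinal.{0}) ∈ Set.Iio (ω_ 1 : Ordinal.{0}) := omega_pos 1
  classical
  -- Player `∀` plays the move `m` next.
  have hstep (q : (I → Move A B) × I) (m : Move A B) : ∃ q' : (I → Move A B) × I,
      pre.le q q' ∧ q.2 < q'.2 ∧ (p q'.1 q.2).1 = m := by
    refine ⟨(Function.update q.1 q.2 m, ⟨q.2.1 + 1, hsucc q.2⟩), ⟨?_, fun ε hε => ?_⟩, ?_, ?_⟩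
    · exact (Order.lt_succ q.2.1).le
    · exact (Function.update_of_ne hε.ne _ _).symm
    · exact Order.lt_succ q.2.1
    · rw [hp]; exact Function.update_self _ _ _
  refine ⟨(I → Move A B) × I, pre, π, ?_, ?_, fun q => ?_, fun q a => ?_, fun q b => ?_,
    fun s hs => ?_⟩
  · exact ⟨(fun _ => Sum.inl (Classical.arbitrary A), ⟨0, hzero⟩)⟩
  · rintro q q' ⟨hle, hq⟩ ab ⟨β, hβ, h⟩
    refine ⟨β, hβ.trans_le hle, ?_⟩
    rwa [← hcongr hq β hβ]
  · have hsub : π q ⊆ (p q.1).relation := fun ab ⟨β, _, h⟩ => ⟨β, h⟩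
    have hiso := (hwin q.1).2
    exact ⟨fun a ha b hb => hiso.eq_iff a (hsub ha) b (hsub hb),
      fun n R t ht => hiso.rel_iff n R t fun i => hsub (ht i)⟩
  · obtain ⟨q', hle, hlt, hm⟩ := hstep q (Sum.inl a)
    rcases (hwin q'.1).1 q.2 with h | h
    · obtain ⟨b, hb⟩ := Sum.isRight_iff.1 h.2
      exact ⟨q', b, hle, q.2, hlt, Or.inl (Prod.ext hm hb)⟩
    · rw [hm] at h
      simp at h
  · obtain ⟨q', hle, hlt, hm⟩ := hstep q (Sum.inr b)
    rcases (hwin q'.1).1 q.2 with h | h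
    · rw [hm] at h
      simp at h
    · obtain ⟨a, ha⟩ := Sum.isLeft_iff.1 h.2
      exact ⟨q', a, hle, q.2, hlt, Or.inr (Prod.ext hm ha)⟩
  · have hsup : (⨆ n, (s n).2.1) < (ω_ 1 : Ordinal.{0}) :=
      Ordinal.iSup_lt_omega_one fun n => (s n).2.2
    let x : I → Move A B := fun ε =>
      if h : ∃ n, ε < (s n).2 then (s h.choose).1 ε else (s 0).1 ε
    refine ⟨(x, ⟨_, hsup⟩), fun n => ⟨Ordinal.le_iSup (fun n => (s n).2.1) n, fun ε hε => ?_⟩⟩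
    have hex : ∃ n, ε < (s n).2 := ⟨n, hε⟩
    have hx : x ε = (s hex.choose).1 ε := dif_pos hex
    show (s n).1 ε = x ε
    rw [hx]
    rcases le_total n hex.choose with hn | hn
    · exact (hs hn).2 ε hε
    · exact ((hs hn).2 ε hex.choose_spec).symm

end Positions

/-! ### Answers that a winning strategy of `∃` must respect -/

section Rigidity

variable {V Q : Type u} {S : Q → Set V} {mA mB : Q → ℕ → Prop}
variable {P : Type v} [Preorder P] {π : P → Set (NodeStructure S mA × NodeStructure S mB)}

theorem Node.exists_label {S : Q → Set V} {mark : Q → ℕ → Prop} {n : Node V Q}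
    (h : ¬ Node.Rel S mark n n) : ∃ l, n = label l := by
  cases n with
  | label l => exact ⟨l, rfl⟩
  | var v b => exact absurd ⟨rfl, rfl⟩ h
  | eqn e X => exact absurd ⟨rfl, rfl⟩ h

theorem Node.not_rel_label (S : Q → Set V) (mark : Q → ℕ → Prop) (l : V ⊕ Q) :
    ¬ Node.Rel S mark (label l) (label l) :=
  irrefl (r := WellOrderingRel) l

theorem IsWinningSystem.rel_iff (hπ : IsWinningSystem binaryLanguage π) {q : P} {a a' b b' : Node V Q}
    (h : (a, b) ∈ π q) (h' : (a', b') ∈ π q) :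
    Node.Rel S mA a a' ↔ Node.Rel S mB b b' :=
  (isPartialIso_iff.1 (hπ.isPartialIso q)).2 _ h _ h'

/-- Labels are fixed, because a well-order is rigid: a label that is moved could be used to
descend to a smaller label that is moved. -/
theorem IsWinningSystem.eq_label (hπ : IsWinningSystem binaryLanguage π) (l : V ⊕ Q) :
    ∀ (q : P) (b : Node V Q), (Node.label l, b) ∈ π q → b = Node.label l := by
  induction l using (IsWellFounded.wf (r := (WellOrderingRel : V ⊕ Q → V ⊕ Q → Prop))).induction with
  | _ l ih =>
  intro q b hb
  obtain ⟨l', rfl⟩ := Node.exists_label (S := S) (mark := mB)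
    (mt (hπ.rel_iff hb hb).2 (Node.not_rel_label S mA l))
  rcases trichotomous_of WellOrderingRel l' l with hl | hl | hl
  · obtain ⟨q', b', hq, hb'⟩ := hπ.forth q (Node.label l')
    rw [ih l' hl q' b' hb'] at hb'
    have := ((hπ.isPartialIso q').eq_iff _ hb' _ (hπ.mono hq hb)).2 rfl
    cases Node.label.inj this
    rfl
  · rw [hl]
  · obtain ⟨q', a, hq, ha⟩ := hπ.back q (Node.label l)
    obtain ⟨l'', rfl⟩ := Node.exists_label (S := S) (mark := mA)
      (mt (hπ.rel_iff ha ha).1 (Node.not_rel_label S mB l))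
    have hlt : WellOrderingRel l'' l := (hπ.rel_iff ha (hπ.mono hq hb)).2 hl
    cases Node.label.inj (ih l'' hlt q' _ ha)
    exact absurd hlt (irrefl _)

theorem IsWinningSystem.eq_var (hπ : IsWinningSystem binaryLanguage π) {q : P} {v : V} {i : Bool}
    {b : Node V Q} (h : (Node.var v i, b) ∈ π q) : ∃ i', b = Node.var v i' := by
  obtain ⟨q', b', hq, hb'⟩ := hπ.forth q (Node.label (Sum.inl v))
  rw [hπ.eq_label _ _ _ hb'] at hb'
  have h' := hπ.mono hq h
  have hrel := (hπ.rel_iff hb' h').1 rfl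
  have hloop := (hπ.rel_iff h' h').1 ⟨rfl, rfl⟩
  cases b with
  | label l => exact absurd hloop (Node.not_rel_label S mB l)
  | var w c => cases hrel; exact ⟨c, rfl⟩
  | eqn e X => cases hrel

open Classical in
theorem IsWinningSystem.eq_eqn (hπ : IsWinningSystem binaryLanguage π) {q : P} {e : Q}
    {X : Finset V} {b : Node V Q} (h : (Node.eqn e X, b) ∈ π q) :
    ∃ Y, b = Node.eqn e Y ∧
      (mA e (X.filter (· ∈ S e)).card ↔ mB e (Y.filter (· ∈ S e)).card) := by
  obtain ⟨q', b', hq, hb'⟩ := hπ.forth q (Node.label (Sum.inr e))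
  rw [hπ.eq_label _ _ _ hb'] at hb'
  have h' := hπ.mono hq h
  have hrel := (hπ.rel_iff hb' h').1 rfl
  have hloop := (hπ.rel_iff h' h').1 ⟨rfl, rfl⟩
  cases b with
  | label l => exact absurd hloop (Node.not_rel_label S mB l)
  | var w c => cases hrel
  | eqn e X =>
    cases hrel
    refine ⟨_, rfl, ?_⟩
    simpa [Node.Rel] using hπ.rel_iff h' hb'

/-- The answers to the empty sets of two conditions agree on their common variables. -/
theorem IsWinningSystem.mem_iff (hπ : IsWinningSystem binaryLanguage π) {q : P} {e e' : Q}
    {Y Y' : Finset V} (h : (Node.eqn e ∅, Node.eqn e Y) ∈ π q)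
    (h' : (Node.eqn e' ∅, Node.eqn e' Y') ∈ π q) {v : V} (hv : v ∈ S e) (hv' : v ∈ S e') :
    v ∈ Y ↔ v ∈ Y' := by
  obtain ⟨q', b, hq, hb⟩ := hπ.forth q (Node.var v false)
  obtain ⟨i, rfl⟩ := hπ.eq_var hb
  have h₁ := hπ.rel_iff hb (hπ.mono hq h)
  have h₂ := hπ.rel_iff hb (hπ.mono hq h')
  simp only [Node.Rel, hv, hv', true_and, Finset.notMem_empty, iff_false] at h₁ h₂
  have h₃ := h₁.1 (by simp)
  have h₄ := h₂.1 (by simp)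
  exact h₃.symm.trans h₄

end Rigidity

/-! ### The conditions for functions that jump over `E` -/

/-- The variables of the system of conditions: `jump i j` says that `h i = j` for an unknown
function `h : Λ → Λ`; `short γ n` says that `h` maps the `n`-th point of the ladder of `γ` below
`γ`; dummy variables occur in no condition and enlarge the structures. -/
inductive JumpVar (Λ D : Type u) : Type u
  | jump (i j : Λ)
  | short (γ : Λ) (n : ℕ)
  | dummy (d : D)

/-- The conditions of the system: `value i` says that the number of `j` with `h i = j` is odd,
`step γ n` says that `short γ n` has the same truth value as the parity of the number of `j < γ`
with `h (η γ n) = j`, and `tail γ` says that only finitely many of the `short γ n` are true. -/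
inductive JumpCond (Λ : Type u) : Type u
  | value (i : Λ)
  | step (γ : Λ) (n : ℕ)
  | tail (γ : Λ)

namespace JumpCond

variable {Λ : Type u} (D : Type u) [LinearOrder Λ]

/-- The variables that occur in a condition. The conditions at `γ ∉ E` are empty. -/
def support (E : Set Λ) (η : Λ → ℕ → Λ) : JumpCond Λ → Set (JumpVar Λ D)
  | value i => {v | ∃ j, v = JumpVar.jump i j}
  | step γ n => {v | γ ∈ E ∧ (v = JumpVar.short γ n ∨ ∃ j < γ, v = JumpVar.jump (η γ n) j)}
  | tail γ => {v | γ ∈ E ∧ ∃ n, v = JumpVar.short γ n}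

/-- In the first structure the sets of even size are marked; nothing is marked at `tail γ`, where
only finiteness matters. -/
def markA : JumpCond Λ → ℕ → Prop
  | value _ => Even
  | step _ _ => Even
  | tail _ => fun _ => False

/-- In the second structure sets of odd size are marked at `value i`. -/
def markB : JumpCond Λ → ℕ → Prop
  | value _ => Odd
  | step _ _ => Even
  | tail _ => fun _ => False

end JumpCond

open Classical in
theorem even_card_filter_symmDiff {V : Type u} (X Y : Finset V) (S : Set V) (hY : ↑Y ⊆ S) :
    Even ((symmDiff X Y).filter (· ∈ S)).card ↔ (Even (X.filter (· ∈ S)).card ↔ Even Y.card) := by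
  have h₁ : (symmDiff X Y).filter (· ∈ S) = (X.filter (· ∈ S) \ Y) ∪ (Y \ X.filter (· ∈ S)) := by
    ext v
    have : v ∈ Y → v ∈ S := fun h => hY h
    simp only [Finset.mem_filter, Finset.mem_symmDiff, Finset.mem_union, Finset.mem_sdiff]
    tauto
  have h₂ : Disjoint (X.filter (· ∈ S) \ Y) (Y \ X.filter (· ∈ S)) :=
    Finset.disjoint_left.2 fun v hv hv' =>
      (Finset.mem_sdiff.1 hv).2 (Finset.mem_sdiff.1 hv').1
  have h₃ := Finset.card_sdiff_add_card_inter (X.filter (· ∈ S)) Y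
  have h₄ := Finset.card_sdiff_add_card_inter Y (X.filter (· ∈ S))
  rw [Finset.inter_comm] at h₄
  rw [h₁, Finset.card_union_of_disjoint h₂, ← h₃, ← h₄]
  simp only [Nat.even_add]
  tauto

theorem flipSet_eq {V Q : Type u} {S : Q → Set V} {F : Set V} {e : Q} {Y : Finset V}
    (hY : F ∩ S e = ↑Y) : flipSet S F e = Y := by
  have h : (F ∩ S e).Finite := hY ▸ Y.finite_toSet
  ext v
  rw [flipSet, dif_pos h, Set.Finite.mem_toFinset, hY, Finset.mem_coe]

section Solution

variable {Λ D : Type u} [LinearOrder Λ] {E : Set Λ} {η : Λ → ℕ → Λ}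

open JumpCond JumpVar

/-- The variables that are true for the function `f`. -/
def trueVars (D : Type u) (E : Set Λ) (η : Λ → ℕ → Λ) (f : Λ → Λ) : Set (JumpVar Λ D)
  | jump i j => j = f i
  | short γ n => γ ∈ E ∧ f (η γ n) < γ
  | dummy _ => False

theorem solves_value (f : Λ → Λ) (i : Λ) :
    Solves (support D E η) markA markB (trueVars D E η f) (value i) := by
  classical
  have hY : trueVars D E η f ∩ support D E η (value i) = ↑({jump i (f i)} : Finset (JumpVar Λ D)) := by
    ext v
    rw [Finset.coe_singleton, Set.mem_singleton_iff]
    constructor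
    · rintro ⟨h, j, rfl⟩
      exact congrArg _ h
    · rintro rfl
      exact ⟨rfl, _, rfl⟩
  refine ⟨hY ▸ Finset.finite_toSet _, fun X => ?_⟩
  rw [flipSet_eq hY]
  change Even _ ↔ Odd _
  rw [← Nat.not_even_iff_odd,
    even_card_filter_symmDiff X _ _ (hY ▸ Set.inter_subset_right), Finset.card_singleton]
  simp

theorem solves_step (f : Λ → Λ) (γ : Λ) (n : ℕ) :
    Solves (support D E η) markA markB (trueVars D E η f) (step γ n) := by
  classical
  have hex : ∃ Y : Finset (JumpVar Λ D),
      trueVars D E η f ∩ support D E η (step γ n) = ↑Y ∧ Even Y.card := by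
    by_cases h : γ ∈ E ∧ f (η γ n) < γ
    · refine ⟨{short γ n, jump (η γ n) (f (η γ n))}, ?_, ?_⟩
      · ext v
        rw [Finset.coe_pair, Set.mem_insert_iff, Set.mem_singleton_iff]
        constructor
        · rintro ⟨hv, -, rfl | ⟨j, -, rfl⟩⟩
          · exact Or.inl rfl
          · exact Or.inr (congrArg _ hv)
        · rintro (rfl | rfl)
          · exact ⟨h, h.1, Or.inl rfl⟩
          · exact ⟨rfl, h.1, Or.inr ⟨_, h.2, rfl⟩⟩
      · rw [Finset.card_pair (by simp)]
        exact even_two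
    · refine ⟨∅, ?_, by simp⟩
      rw [Finset.coe_empty, Set.eq_empty_iff_forall_notMem]
      rintro v ⟨hv, hγ, rfl | ⟨j, hj, rfl⟩⟩
      · exact h hv
      · have hv' : j = f (η γ n) := hv
        exact h ⟨hγ, hv' ▸ hj⟩
  obtain ⟨Y, hY, hYeven⟩ := hex
  refine ⟨hY ▸ Finset.finite_toSet _, fun X => ?_⟩
  rw [flipSet_eq hY]
  change Even _ ↔ Even _
  rw [even_card_filter_symmDiff X _ _ (hY ▸ Set.inter_subset_right)]
  simp [hYeven]

theorem solves_tail (f : Λ → Λ) (γ : Λ) (hf : γ ∈ E → {n | f (η γ n) < γ}.Finite) :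
    Solves (support D E η) markA markB (trueVars D E η f) (tail γ) := by
  refine ⟨?_, fun X => Iff.rfl⟩
  by_cases hγ : γ ∈ E
  · refine ((hf hγ).image fun n => short γ n).subset ?_
    rintro v ⟨hv, -, n, rfl⟩
    exact ⟨n, hv.2, rfl⟩
  · convert Set.finite_empty
    rw [Set.eq_empty_iff_forall_notMem]
    rintro v ⟨-, h, -⟩
    exact hγ h

/-- The index of a variable. -/
def JumpVar.index (l₀ : Λ) : JumpVar Λ D → Λ
  | jump i _ => i
  | short γ _ => γ
  | dummy _ => l₀

/-- The index of a condition. -/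
def JumpCond.index : JumpCond Λ → Λ
  | value i => i
  | step γ _ => γ
  | tail γ => γ

/-- Below `δ ∈ T` the function `h δ` solves all conditions, and its initial parts recur. -/
theorem not_forallWins_jump (hΛ : IsSuccLike Λ (ℵ_ 2)) (hηlt : ∀ γ ∈ E, ∀ n, η γ n < γ) {T : Set Λ}
    (hT : MeetsClosurePoints T) {h : Λ → Λ → Λ}
    (hh : ∀ δ ∈ T, ∀ s : Set Λ, s.Countable → (∀ x ∈ s, x < δ) →
        ∃ γ < δ, (∀ x ∈ s, x < γ) ∧ ∀ i < γ, h γ i = h δ i)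
    (hfin : ∀ δ ∈ T, ∀ γ ∈ E, γ < δ → {n | h δ (η γ n) < γ}.Finite) :
    ¬ ForallWins binaryLanguage (NodeStructure (support D E η) markA)
      (NodeStructure (support D E η) markB) (ω_ 1 : Ordinal.{0}) := by
  obtain ⟨l₀, -⟩ := hΛ.exists_gt ∅ (by simp)
  refine not_forallWins hΛ (iV := JumpVar.index l₀) (iQ := JumpCond.index) ?_ hT
    (F := fun δ => trueVars D E η (h δ)) (fun δ hδ s hs hsδ => ?_) fun δ hδ e he => ?_
  · rintro (i | ⟨γ, n⟩ | γ) v hv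
    · obtain ⟨j, rfl⟩ := hv
      exact le_rfl
    · obtain ⟨hγ, rfl | ⟨j, -, rfl⟩⟩ := hv
      · exact le_rfl
      · exact (hηlt γ hγ n).le
    · obtain ⟨-, n, rfl⟩ := hv
      exact le_rfl
  · obtain ⟨γ, hγδ, hγ, heq⟩ := hh δ hδ s hs hsδ
    refine ⟨γ, hγδ, hγ, ?_⟩
    rintro (⟨i, j⟩ | ⟨γ', n⟩ | d) hv
    · change j = h γ i ↔ j = h δ i
      rw [heq i hv]
    · change γ' ∈ E ∧ h γ (η γ' n) < γ' ↔ γ' ∈ E ∧ h δ (η γ' n) < γ'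
      refine and_congr_right fun hE => ?_
      rw [heq _ ((hηlt γ' hE n).trans hv)]
    · exact Iff.rfl
  · cases e with
    | value i => exact solves_value _ i
    | step γ n => exact solves_step _ γ n
    | tail γ => exact solves_tail _ γ fun hγ => hfin δ hδ γ hγ he

/-- Player `∀` first asks for the values of `h` at the points of the ladder of some `γ ∈ E` which
is closed under the answers of `∃` to such questions; so these values lie below `γ`. In reply
to the question `tail γ`, player `∃` has to claim that some `short γ n` is false, which is refuted
by the question `step γ n`. -/
theorem not_existsWins_jump [WellFoundedLT Λ] (hΛ : IsSuccLike Λ (ℵ_ 2))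
    (hE : MeetsClosurePoints E) (hηlt : ∀ γ ∈ E, ∀ n, η γ n < γ) :
    ¬ ExistsWins binaryLanguage (NodeStructure (support D E η) markA)
      (NodeStructure (support D E η) markB) (ω_ 1 : Ordinal.{0}) := by
  classical
  intro hwin
  obtain ⟨l₀, -⟩ := hΛ.exists_gt ∅ (by simp)
  have : Nonempty (NodeStructure (support D E η) markA) := ⟨Node.eqn (tail l₀) ∅⟩
  obtain ⟨P, _, π, ⟨q₀⟩, hπ⟩ := hwin.exists_isWinningSystem
  -- `next q i` is a position after asking for the value at `i`, and `ans q i` is the answer.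
  have hnext (q : P) (i : Λ) : ∃ (q' : P) (Y : Finset (JumpVar Λ D)), q ≤ q' ∧
      (Node.eqn (value i) ∅, Node.eqn (value i) Y) ∈ π q' ∧
      Odd (Y.filter (· ∈ support D E η (value i))).card := by
    obtain ⟨q', b, hq, hb⟩ := hπ.forth q (Node.eqn (value i) ∅)
    obtain ⟨Y, rfl, hY⟩ := hπ.eq_eqn hb
    exact ⟨q', Y, hq, hb, hY.1 (by simp [markA])⟩
  choose next ans hnext hans hodd using hnext
  have hbound (q : P) (i : Λ) : ∃ b, ∀ j, jump i j ∈ ans q i → j < b := by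
    have hfin : {j | (jump i j : JumpVar Λ D) ∈ ans q i}.Finite :=
      (ans q i).finite_toSet.preimage (f := fun j => jump i j) fun j _ j' _ h => by
        simpa using h
    obtain ⟨b, hb⟩ := hΛ.exists_gt _ ((hfin.lt_aleph0.le).trans (aleph0_le_aleph 2))
    exact ⟨b, hb⟩
  choose bound hbound using hbound
  let pos (l : List Λ) : P := l.foldl next q₀
  have hg (x : Λ) : ∃ b, ∀ l : List Λ, (∀ i ∈ l, i ≤ x) → ∀ i ≤ x, bound (pos l) i < b := by
    have hcard : #(List (Set.Iic x) × Set.Iic x) ≤ ℵ_ 2 := by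
      rw [mk_prod, Cardinal.lift_id, Cardinal.lift_id]
      exact mul_le_of_le (aleph0_le_aleph 2) ((mk_list_le_max _).trans
        (max_le (aleph0_le_aleph 2) (hΛ.mk_Iic_le x))) (hΛ.mk_Iic_le x)
    obtain ⟨b, hb⟩ := hΛ.exists_gt_range hcard
      fun li => bound (pos (li.1.map Subtype.val)) li.2.1
    refine ⟨b, fun l hl i hi => ?_⟩
    lift l to List (Set.Iic x) using hl
    exact hb (l, ⟨i, hi⟩)
  choose g hg using hg
  obtain ⟨γ, hγE, hγ⟩ := hE g
  let q (n : ℕ) : P := pos ((List.range n).map (η γ))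
  have hq (n : ℕ) : q (n + 1) = next (q n) (η γ n) := by
    simp [q, pos, List.range_succ]
  obtain ⟨r, hr⟩ := hπ.exists_ub q (monotone_nat_of_le_succ fun n => (hq n).symm ▸ hnext _ _)
  have hlt (n : ℕ) (j : Λ) (hj : jump (η γ n) j ∈ ans (q n) (η γ n)) : j < γ := by
    obtain ⟨m, -, hm⟩ := Finset.exists_max_image (Finset.range (n + 1)) (η γ) (by simp)
    refine ((hbound _ _ j hj).trans (hg (η γ m) _ ?_ _ ?_)).trans (hγ _ (hηlt γ hγE m))
    · intro i hi
      obtain ⟨k, hk, rfl⟩ := List.mem_map.1 hi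
      exact hm k (Finset.mem_range.2 ((List.mem_range.1 hk).trans n.lt_succ_self))
    · exact hm n (Finset.self_mem_range_succ n)
  obtain ⟨r₁, b, hr₁, hb⟩ := hπ.forth r (Node.eqn (tail γ) ∅)
  obtain ⟨Y, rfl, -⟩ := hπ.eq_eqn hb
  obtain ⟨n, hn⟩ : ∃ n, (short γ n : JumpVar Λ D) ∉ Y := by
    by_contra! h
    exact Set.infinite_of_injective_forall_mem (f := fun n => (short γ n : JumpVar Λ D))
      (fun m n h => by simpa using h) h Y.finite_toSet
  obtain ⟨r₂, b, hr₂, hZ⟩ := hπ.forth r₁ (Node.eqn (step γ n) ∅)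
  obtain ⟨Z, rfl, hZeven⟩ := hπ.eq_eqn hZ
  have hshort : (short γ n : JumpVar Λ D) ∉ Z :=
    mt (hπ.mem_iff (hπ.mono hr₂ hb) hZ ⟨hγE, n, rfl⟩ ⟨hγE, Or.inl rfl⟩).2 hn
  have hval : (Node.eqn (value (η γ n)) ∅, Node.eqn (value (η γ n)) (ans (q n) (η γ n))) ∈ π r₂ := by
    refine hπ.mono (((hr (n + 1)).trans hr₁).trans hr₂) ?_
    rw [hq]
    exact hans _ _
  have heq : Z.filter (· ∈ support D E η (step γ n)) =
      (ans (q n) (η γ n)).filter (· ∈ support D E η (value (η γ n))) := by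
    ext v
    rw [Finset.mem_filter, Finset.mem_filter]
    constructor
    · rintro ⟨hv, hs⟩
      have hs' := hs
      obtain ⟨-, rfl | ⟨j, hj, rfl⟩⟩ := hs'
      · exact absurd hv hshort
      · exact ⟨(hπ.mem_iff hZ hval hs ⟨j, rfl⟩).1 hv, j, rfl⟩
    · rintro ⟨hv, hs⟩
      have hs' := hs
      obtain ⟨j, rfl⟩ := hs'
      have hs'' : jump (η γ n) j ∈ support D E η (step γ n) :=
        ⟨hγE, Or.inr ⟨j, hlt n j hv, rfl⟩⟩
      exact ⟨(hπ.mem_iff hZ hval hs'' hs).2 hv, hs''⟩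
  have heven : Even (Z.filter (· ∈ support D E η (step γ n))).card :=
    hZeven.1 (by simp [markA])
  rw [heq] at heven
  exact Nat.not_even_iff_odd.2 (hodd _ _) heven

end Solution

/-! ### Cardinality of the structures -/

section Cardinality

variable {Λ D : Type u}

theorem mk_jumpVar {κ : Cardinal.{u}} (hκ : ℵ₀ ≤ κ) (hΛ : #Λ ≤ κ) (hD : #D = κ) :
    #(JumpVar Λ D) = κ := by
  refine le_antisymm ?_ ?_
  · let f : JumpVar Λ D → (Λ × Λ) ⊕ (Λ × ULift.{u} ℕ) ⊕ D
      | .jump i j => Sum.inl (i, j)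
      | .short γ n => Sum.inr (Sum.inl (γ, ⟨n⟩))
      | .dummy d => Sum.inr (Sum.inr d)
    have hf : Function.Injective f := by
      rintro (_ | _ | _) (_ | _ | _) h <;> simp [f] at h <;> simp [h]
    refine (mk_le_of_injective hf).trans ?_
    simp only [mk_sum, mk_prod, Cardinal.lift_id]
    refine add_le_of_le hκ (mul_le_of_le hκ hΛ hΛ) (add_le_of_le hκ (mul_le_of_le hκ hΛ ?_) hD.le)
    simpa using hκ
  · rw [← hD]
    exact mk_le_of_injective (f := JumpVar.dummy) fun d d' h => by simpa using h

theorem mk_jumpCond_le {κ : Cardinal.{u}} (hκ : ℵ₀ ≤ κ) (hΛ : #Λ ≤ κ) : #(JumpCond Λ) ≤ κ := by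
  let f : JumpCond Λ → Λ ⊕ (Λ × ULift.{u} ℕ) ⊕ Λ
    | .value i => Sum.inl i
    | .step γ n => Sum.inr (Sum.inl (γ, ⟨n⟩))
    | .tail γ => Sum.inr (Sum.inr γ)
  have hf : Function.Injective f := by
    rintro (_ | _ | _) (_ | _ | _) h <;> simp [f] at h <;> simp [h]
  refine (mk_le_of_injective hf).trans ?_
  simp only [mk_sum, mk_prod, Cardinal.lift_id]
  refine add_le_of_le hκ hΛ (add_le_of_le hκ (mul_le_of_le hκ hΛ ?_) hΛ)
  simpa using hκ

theorem mk_node {V Q : Type u} {κ : Cardinal.{u}} (hκ : ℵ₀ ≤ κ) (hV : #V = κ) (hQ : #Q ≤ κ) :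
    #(Node V Q) = κ := by
  have : Infinite V := infinite_iff.2 (hκ.trans_eq hV.symm)
  refine le_antisymm ?_ ?_
  · let f : Node V Q → (V ⊕ Q) ⊕ (V × ULift.{u} Bool) ⊕ (Q × Finset V)
      | .label l => Sum.inl l
      | .var v b => Sum.inr (Sum.inl (v, ⟨b⟩))
      | .eqn e X => Sum.inr (Sum.inr (e, X))
    have hf : Function.Injective f := by
      rintro (_ | _ | _) (_ | _ | _) h <;> simp [f] at h <;> simp [h]
    refine (mk_le_of_injective hf).trans ?_
    simp only [mk_sum, mk_prod, Cardinal.lift_id, mk_finset_of_infinite]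
    refine add_le_of_le hκ (add_le_of_le hκ hV.le hQ) (add_le_of_le hκ (mul_le_of_le hκ hV.le ?_)
      (mul_le_of_le hκ hQ hV.le))
    exact (lt_aleph0_of_finite _).le.trans hκ
  · rw [← hV]
    exact mk_le_of_injective (f := fun v => Node.var v true) fun v v' h => by simpa using h

end Cardinality

end EFGame

theorem theorem5 (κ : Cardinal.{u}) (hκ : ℵ_ 3 ≤ κ) :
    ∃ (A B : Type u) (_ : EFGame.binaryLanguage.Structure A)
      (_ : EFGame.binaryLanguage.Structure B),
      #A = κ ∧ #B = κ ∧
        ¬ EFGame.Determined EFGame.binaryLanguage A B (ω_ 1 : Ordinal.{0}) := by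
  have hsucc₁ : Order.succ (ℵ₁ : Cardinal.{u}) = ℵ_ 2 := by
    rw [succ_aleph, one_add_one_eq_two]
  have hsucc₂ : Order.succ (ℵ_ 2 : Cardinal.{u}) = ℵ_ 3 := by
    rw [succ_aleph, two_add_one_eq_three]
  let Λ : Type u := (Order.succ (ℵ_ 2 : Cardinal.{u})).ord.ToType
  let K : Type u := (Order.succ (ℵ₁ : Cardinal.{u})).ord.ToType
  have hΛ : EFGame.IsSuccLike Λ (ℵ_ 2) := EFGame.isSuccLike_succ_ord (aleph0_le_aleph 2)
  have hK : EFGame.IsSuccLike K ℵ₁ := EFGame.isSuccLike_succ_ord (aleph0_le_aleph 1)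
  have hKcard : #K = ℵ_ 2 := (mk_ord_toType _).trans hsucc₁
  have hΛcard : #Λ ≤ κ := ((mk_ord_toType _).trans hsucc₂).trans_le hκ
  have hκ₀ : ℵ₀ ≤ κ := (aleph0_le_aleph 3).trans hκ
  obtain ⟨E, T, η, h, hE, hη, hT, hh, hfin⟩ := EFGame.exists_coherent_jumps hΛ hK hKcard
  have hcard : #(EFGame.Node (EFGame.JumpVar Λ κ.out) (EFGame.JumpCond Λ)) = κ :=
    EFGame.mk_node hκ₀ (EFGame.mk_jumpVar hκ₀ hΛcard (mk_out κ)) (EFGame.mk_jumpCond_le hκ₀ hΛcard)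
  refine ⟨EFGame.NodeStructure (EFGame.JumpCond.support κ.out E η) EFGame.JumpCond.markA,
    EFGame.NodeStructure (EFGame.JumpCond.support κ.out E η) EFGame.JumpCond.markB,
    inferInstance, inferInstance, hcard, hcard, ?_⟩
  rintro (hwin | hwin)
  · exact EFGame.not_forallWins_jump hΛ hη hT hh hfin hwin
  · exact EFGame.not_existsWins_jump hΛ hE hη hwin
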